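/- Let $(X_t)_{t\ge 1}$ be i.i.d. random vectors in $\mathbb{R}^2$ with $\mathbb{E}|X_1|^{2+\gamma}<\infty$ for some $\gamma>0$. For $\delta>0$ let $$w(U):=\big(\log(e+|U|)\big)^{-\frac12-\delta},\qquad U\in\mathbb{R},$$ and for $n\ge 1$ let $$C_n(u):=\frac{1}{\sqrt n}\sum_{t=1}^{n}\Big(e^{i\langle u,X_t\rangle}-\mathbb{E}\big[e^{i\langle u,X_1\rangle}\big]\Big),\qquad u\in\mathbb{R}^2,$$ be the normalized empirical characteristic function process. Then $$\sup_{n\ge 1}\ \mathbb{E}\Big[\sup_{U\in\mathbb{R}}\big|C_n\big((U,U)\big)\big|\,w(U)\Big]<\infty .$$ -/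

import Mathlib

open MeasureTheory ProbabilityTheory
open scoped ENNReal

noncomputable section

/-- The plane `ℝ²` with its Euclidean norm and inner product. -/
abbrev Plane : Type := EuclideanSpace ℝ (Fin 2)

/-- The point `(U, U)` of the diagonal of `ℝ²`. -/
def diagPoint (U : ℝ) : Plane := !₂[U, U]

/-- The weight function `w(U) = (log (e + |U|)) ^ (-1/2 - δ)`. -/
def ecfWeight (δ U : ℝ) : ℝ :=
  Real.log (Real.exp 1 + |U|) ^ (-(1 / 2 : ℝ) - δ)

/-- The normalized empirical characteristic function process
`C_n(u) = n^{-1/2} ∑ (exp (i ⟨u, X_t⟩) - E exp (i ⟨u, X_1⟩))`, the sum being over the first `n`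
members of the sequence (which Lean numbers from `0`, so that `X 0` is the first one). -/
def ecfProcess {Ω : Type*} [MeasurableSpace Ω] (P : Measure Ω) (X : ℕ → Ω → Plane)
    (n : ℕ) (u : Plane) (ω : Ω) : ℂ :=
  ((1 / Real.sqrt n : ℝ) : ℂ) *
    ∑ t ∈ Finset.range n,
      (Complex.exp (Complex.I * ((inner ℝ u (X t ω) : ℝ) : ℂ))
        - ∫ ω', Complex.exp (Complex.I * ((inner ℝ u (X 0 ω') : ℝ) : ℂ)) ∂P)

/-- The weighted supremum norm over the diagonal, `sup_U |f(U, U)| w(U)`, with values in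
`[0, ∞]`. -/
def diagWeightedSup (δ : ℝ) (f : Plane → ℂ) : ℝ≥0∞ :=
  ⨆ U : ℝ, ENNReal.ofReal (‖f (diagPoint U)‖ * ecfWeight δ U)

end

noncomputable section

/-! On the diagonal only the real variables $Y_t = X_{t,0} + X_{t,1}$ matter, and the real and
imaginary parts of $C_n$ are fluctuations $f(U)$ of $\cos(Uy)$ and $\sin(Uy)$. At a fixed $U$,
Hoeffding makes $f(U)$ sub-Gaussian, so $E\,e^{f(U)^2/4}$ is bounded uniformly in $n$ and $U$;
likewise $E f'(U)^2 \le E Y_0^2$. A one-dimensional Sobolev argument replaces chaining: the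
fundamental theorem of calculus bounds $G = e^{f^2/12}/(1+U^2)$ at every $U$ by $1 + \int |G'|$, and
$|G'| \le (f'^2 + 2e^{f^2/4})/(1+u^2)$ has integrable mean (`exp_sq_div_le_lintegral`,
`exists_maximal_normalizedFluctuation`). Taking logarithms, $f(U)^2$ is at most a random constant
plus a multiple of $\log(e+|U|)$, which the weight absorbs (`abs_mul_ecfWeight_le`). -/

/-- The normalized centred sum `n^{-1/2} ∑_{t < n} (g (Y t) - E g (Y 0))`. -/
def normalizedFluctuation {Ω E : Type*} [MeasurableSpace Ω] (P : Measure Ω) (Y : ℕ → Ω → E)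
    (n : ℕ) (g : E → ℝ) (ω : Ω) : ℝ :=
  (Real.sqrt n)⁻¹ * ∑ t ∈ Finset.range n, (g (Y t ω) - ∫ ω', g (Y 0 ω') ∂P)

/-! ### Tails and variance for one fixed test function. -/

section Fluctuation

variable {Ω E : Type*} [MeasurableSpace Ω] [MeasurableSpace E] {P : Measure Ω}
  {Y : ℕ → Ω → E}

theorem measurable_normalizedFluctuation (hmeas : ∀ t, Measurable (Y t)) (n : ℕ) {g : E → ℝ}
    (hg : Measurable g) : Measurable (normalizedFluctuation P Y n g) := by
  unfold normalizedFluctuation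
  exact (Finset.measurable_sum _ fun t _ => (hg.comp (hmeas t)).sub_const _).const_mul _

variable [IsProbabilityMeasure P]

/-- Hoeffding: the normalized centred sum of a function bounded by `1` is sub-Gaussian with
variance proxy `1`. -/
theorem hasSubgaussianMGF_normalizedFluctuation (hmeas : ∀ t, Measurable (Y t))
    (hindep : iIndepFun Y P) (hident : ∀ t, IdentDistrib (Y t) (Y 0) P P) {n : ℕ} (hn : 1 ≤ n)
    {g : E → ℝ} (hg : Measurable g) (hbound : ∀ y, |g y| ≤ 1) :
    HasSubgaussianMGF (normalizedFluctuation P Y n g) 1 P := by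
  have hsum : HasSubgaussianMGF
      (fun ω => ∑ t ∈ Finset.range n, (g (Y t ω) - ∫ ω', g (Y 0 ω') ∂P))
      (∑ _t ∈ Finset.range n, 1) P := by
    refine HasSubgaussianMGF.sum_of_iIndepFun
      (X := fun t ω => g (Y t ω) - ∫ ω', g (Y 0 ω') ∂P)
      (hindep.comp (fun _ y => g y - ∫ ω', g (Y 0 ω') ∂P) fun _ => hg.sub_const _)
      fun t _ => ?_
    have h := hasSubgaussianMGF_of_mem_Icc (μ := P) (X := fun ω => g (Y t ω)) (a := -1) (b := 1)
      (hg.comp (hmeas t)).aemeasurable (.of_forall fun ω => abs_le.mp (hbound _))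
    have hmean : ∫ ω', g (Y t ω') ∂P = ∫ ω', g (Y 0 ω') ∂P :=
      ((hident t).comp hg).integral_eq
    rw [hmean] at h
    -- Hoeffding's proxy is the squared half-length of $[-1,1]$, namely $1$.
    convert h using 1
    ext
    norm_num
  have h : HasSubgaussianMGF (normalizedFluctuation P Y n g)
      (.mk ((Real.sqrt n)⁻¹ ^ 2) (sq_nonneg _) * ∑ _t ∈ Finset.range n, 1) P :=
    hsum.const_mul (Real.sqrt n)⁻¹
  have hone : (.mk ((Real.sqrt n)⁻¹ ^ 2) (sq_nonneg _) * ∑ _t ∈ Finset.range n, 1 : NNReal) = 1 := by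
    have hn0 : (n : ℝ) ≠ 0 := by positivity
    refine NNReal.coe_injective ?_
    rw [NNReal.coe_mul, NNReal.coe_mk]
    simp [hn0]
  rwa [hone] at h

/-- The second moment of the normalized centred sum is at most that of one summand. -/
theorem lintegral_normalizedFluctuation_sq_le (hmeas : ∀ t, Measurable (Y t))
    (hindep : iIndepFun Y P) (hident : ∀ t, IdentDistrib (Y t) (Y 0) P P) {n : ℕ} (hn : 1 ≤ n)
    {g : E → ℝ} (hg : Measurable g) (hL2 : MemLp (fun ω => g (Y 0 ω)) 2 P) :
    ∫⁻ ω, ENNReal.ofReal (normalizedFluctuation P Y n g ω ^ 2) ∂P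
      ≤ ENNReal.ofReal (∫ ω, g (Y 0 ω) ^ 2 ∂P) := by
  set m := ∫ ω', g (Y 0 ω') ∂P with hm
  have hid : ∀ t, IdentDistrib (fun ω => g (Y t ω)) (fun ω => g (Y 0 ω)) P P :=
    fun t => (hident t).comp hg
  have hZ : ∀ t, MemLp (fun ω => g (Y t ω) - m) 2 P :=
    fun t => ((hid t).symm.memLp_iff.1 hL2).sub (memLp_const _)
  have hmem : MemLp (normalizedFluctuation P Y n g) 2 P :=
    (memLp_finsetSum _ fun t _ => hZ t).const_mul _
  have hmean : ∫ ω, normalizedFluctuation P Y n g ω ∂P = 0 := by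
    unfold normalizedFluctuation
    rw [integral_const_mul, integral_finsetSum _ fun t _ => (hZ t).integrable one_le_two,
      Finset.sum_eq_zero, mul_zero]
    intro t _
    rw [integral_sub (((hid t).symm.memLp_iff.1 hL2).integrable one_le_two)
      (integrable_const _), (hid t).integral_eq]
    simp [hm]
  have hvar : variance (normalizedFluctuation P Y n g) P = variance (fun ω => g (Y 0 ω)) P := by
    unfold normalizedFluctuation
    rw [variance_const_mul]
    have hs := IndepFun.variance_sum (μ := P) (s := Finset.range n)
      (X := fun t ω => g (Y t ω) - m) (fun t _ => hZ t)
      (fun i _ j _ hij => (hindep.indepFun hij).comp (hg.sub_const m) (hg.sub_const m))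
    have hv : ∀ t, variance (fun ω => g (Y t ω) - m) P = variance (fun ω => g (Y 0 ω)) P :=
      fun t => by
        rw [variance_sub_const (X := fun ω => g (Y t ω))
          (hg.comp (hmeas t)).aestronglyMeasurable, (hid t).variance_eq]
    simp only [hv, Finset.sum_const, Finset.card_range, nsmul_eq_mul] at hs
    have hfun : (∑ i ∈ Finset.range n, fun ω => g (Y i ω) - m)
        = fun ω => ∑ t ∈ Finset.range n, (g (Y t ω) - m) := by
      ext; simp
    rw [hfun] at hs
    rw [hs]
    have : (n : ℝ) ≠ 0 := by positivity
    field_simp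
    rw [Real.sq_sqrt (by positivity)]
  rw [← ofReal_integral_eq_lintegral_ofReal hmem.integrable_sq
    (.of_forall fun ω => sq_nonneg _)]
  refine ENNReal.ofReal_le_ofReal ?_
  rw [← variance_of_integral_eq_zero hmem.aemeasurable hmean, hvar]
  exact variance_le_expectation_sq (hg.comp (hmeas 0)).aestronglyMeasurable

end Fluctuation

/-! ### Exponential square moments and a Sobolev-type bound. -/

theorem lintegral_exp_sq_gaussianReal_lt_top :
    ∫⁻ y, ENNReal.ofReal (Real.exp (y ^ 2 / 4)) ∂(gaussianReal 0 1) < ⊤ := by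
  rw [gaussianReal_of_var_ne_zero _ one_ne_zero,
    lintegral_withDensity_eq_lintegral_mul _ (measurable_gaussianPDF _ _) (by fun_prop)]
  have hint : Integrable fun y : ℝ => (Real.sqrt (2 * Real.pi))⁻¹ * Real.exp (-(1 / 4) * y ^ 2) :=
    (integrable_exp_neg_mul_sq (by norm_num)).const_mul _
  refine lt_of_eq_of_lt (lintegral_congr fun y => ?_) hint.lintegral_lt_top
  rw [Pi.mul_apply, gaussianPDF, ← ENNReal.ofReal_mul (gaussianPDFReal_nonneg _ _ _),
    gaussianPDFReal, mul_assoc, ← Real.exp_add]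
  congr 3
  · simp
  · simp; ring

/-- Exponential square integrability of sub-Gaussian variables, uniformly in the variable. -/
theorem lintegral_exp_sq_le_of_hasSubgaussianMGF {Ω : Type*} [MeasurableSpace Ω]
    {P : Measure Ω} [IsProbabilityMeasure P] {Z : Ω → ℝ} (hZm : Measurable Z)
    (hZ : HasSubgaussianMGF Z 1 P) :
    ∫⁻ ω, ENNReal.ofReal (Real.exp (Z ω ^ 2 / 4)) ∂P
      ≤ ∫⁻ y, ENNReal.ofReal (Real.exp (y ^ 2 / 4)) ∂(gaussianReal 0 1) := by
  -- Linearize the square: $e^{x^2/4} = E\,e^{sxN}$ for a standard Gaussian $N$, since $s^2/2 =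
  -- 1/4$. After exchanging integrals only the moment generating function of `Z` is needed.
  set s : ℝ := Real.sqrt (1 / 2)
  have hs : s ^ 2 = 1 / 2 := Real.sq_sqrt (by norm_num)
  have hgauss : ∀ x : ℝ, ENNReal.ofReal (Real.exp (x ^ 2 / 4))
      = ∫⁻ y, ENNReal.ofReal (Real.exp (s * x * y)) ∂(gaussianReal 0 1) := by
    intro x
    rw [← ofReal_integral_eq_lintegral_ofReal (integrable_exp_mul_gaussianReal _)
      (.of_forall fun y => (Real.exp_pos _).le)]
    have h := mgf_gaussianReal (p := gaussianReal 0 1) (X := id) (μ := 0) (v := 1) (by simp) (s * x)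
    simp only [mgf, id] at h
    rw [h]
    congr 2
    rw [mul_pow, hs]
    push_cast
    ring
  simp_rw [hgauss (Z _)]
  rw [lintegral_lintegral_swap (by fun_prop)]
  refine lintegral_mono fun y => ?_
  have hrw : ∀ ω, s * Z ω * y = s * y * Z ω := fun ω => by ring
  simp_rw [hrw]
  rw [← ofReal_integral_eq_lintegral_ofReal (hZ.integrable_exp_mul _)
    (.of_forall fun y => (Real.exp_pos _).le)]
  refine ENNReal.ofReal_le_ofReal ((hZ.mgf_le _).trans_eq ?_)
  rw [mul_pow, hs]
  congr 1
  push_cast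
  ring

/-- A weighted supremum bound on the line, by the fundamental theorem of calculus. -/
theorem exp_sq_div_le_lintegral {f f' : ℝ → ℝ} (hf0 : f 0 = 0)
    (hf : ∀ u, HasDerivAt f (f' u) u) (hf' : Continuous f') (U : ℝ) :
    ENNReal.ofReal (Real.exp (f U ^ 2 / 12) / (1 + U ^ 2))
      ≤ 1 + ∫⁻ v, (ENNReal.ofReal (f' v ^ 2) + 2 * ENNReal.ofReal (Real.exp (f v ^ 2 / 4)))
          * ENNReal.ofReal ((1 + v ^ 2)⁻¹) := by
  have hfc : Continuous f := continuous_iff_continuousAt.2 fun u => (hf u).continuousAt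
  have hpos : ∀ u : ℝ, 0 < 1 + u ^ 2 := fun u => by positivity
  -- The exponent $1/12$ leaves room for the derivative: with $F = e^{f^2/12}$ one has $f^2 \le
  -- 12F$, so the factor $f^2F^2$ met below is still at most $12F^3 = 12e^{f^2/4}$.
  set G : ℝ → ℝ := fun u => Real.exp (f u ^ 2 / 12) / (1 + u ^ 2) with hG
  set G' : ℝ → ℝ := fun u => (f u * f' u / 6 * Real.exp (f u ^ 2 / 12) * (1 + u ^ 2)
    - Real.exp (f u ^ 2 / 12) * (2 * u)) / (1 + u ^ 2) ^ 2 with hG'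
  have hderiv : ∀ u, HasDerivAt G (G' u) u := by
    intro u
    have h1 : HasDerivAt (fun u => Real.exp (f u ^ 2 / 12))
        (f u * f' u / 6 * Real.exp (f u ^ 2 / 12)) u := by
      refine (((hf u).pow 2).div_const 12).exp.congr_deriv ?_
      simp
      ring
    have h2 : HasDerivAt (fun u : ℝ => 1 + u ^ 2) (2 * u) u := by
      refine ((hasDerivAt_pow 2 u).const_add 1).congr_deriv ?_
      simp
    exact h1.div h2 (hpos u).ne'
  have hG'c : Continuous G' := by
    refine Continuous.div (by fun_prop) (by fun_prop) fun u => ?_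
    have := hpos u
    positivity
  have hbound : ∀ u, ‖G' u‖
      ≤ (f' u ^ 2 + 2 * Real.exp (f u ^ 2 / 4)) * (1 + u ^ 2)⁻¹ := by
    intro u
    set F := Real.exp (f u ^ 2 / 12) with hF
    have hF1 : 1 + f u ^ 2 / 12 ≤ F := by
      have := Real.add_one_le_exp (f u ^ 2 / 12); linarith
    have hF3 : Real.exp (f u ^ 2 / 4) = F ^ 3 := by
      rw [hF, ← Real.exp_nat_mul]; congr 1; push_cast; ring
    have hF0 : 1 ≤ F := by nlinarith [sq_nonneg (f u)]
    have hFF : F ≤ F ^ 3 := le_self_pow₀ hF0 (by norm_num)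
    have hfF : f u ^ 2 * F ^ 2 ≤ 12 * F ^ 3 := by
      have : f u ^ 2 ≤ 12 * F := by linarith
      nlinarith [mul_le_mul_of_nonneg_right this (sq_nonneg F)]
    -- AM-GM on $2 \cdot f' \cdot (fF/12)$.
    have hcross : |f u * f' u / 6 * F| ≤ f' u ^ 2 + F ^ 3 := by
      rw [abs_le]
      constructor <;>
        nlinarith [sq_nonneg (f' u + f u * F / 12), sq_nonneg (f' u - f u * F / 12)]
    have h2u : |2 * u| ≤ 1 + u ^ 2 := by
      rw [abs_le]; constructor <;> nlinarith [sq_nonneg (u - 1), sq_nonneg (u + 1)]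
    rw [hF3, Real.norm_eq_abs, hG']
    simp only
    rw [abs_div, abs_of_pos (pow_pos (hpos u) 2), div_le_iff₀ (pow_pos (hpos u) 2)]
    have hR : (f' u ^ 2 + 2 * F ^ 3) * (1 + u ^ 2)⁻¹ * (1 + u ^ 2) ^ 2
        = (f' u ^ 2 + F ^ 3) * (1 + u ^ 2) + F ^ 3 * (1 + u ^ 2) := by
      have := (hpos u).ne'
      field_simp
      ring
    rw [hR]
    refine (abs_sub _ _).trans (add_le_add ?_ ?_)
    · rw [abs_mul, abs_of_pos (hpos u)]
      exact mul_le_mul_of_nonneg_right hcross (hpos u).le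
    · rw [abs_mul, abs_of_pos (by linarith : 0 < F)]
      exact mul_le_mul hFF h2u (abs_nonneg _) (by positivity)
  have hftc : G U = 1 + ∫ v in (0 : ℝ)..U, G' v := by
    rw [intervalIntegral.integral_eq_sub_of_hasDerivAt (fun v _ => hderiv v)
      (hG'c.intervalIntegrable _ _)]
    simp [hG, hf0]
  calc ENNReal.ofReal (G U)
      ≤ ENNReal.ofReal (1 + ‖∫ v in (0 : ℝ)..U, G' v‖) :=
        ENNReal.ofReal_le_ofReal (by rw [hftc]; gcongr; exact Real.le_norm_self _)
    _ = 1 + ‖∫ v in (0 : ℝ)..U, G' v‖ₑ := by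
        rw [ENNReal.ofReal_add zero_le_one (norm_nonneg _), ENNReal.ofReal_one, ofReal_norm]
    _ ≤ 1 + ∫⁻ v, ‖G' v‖ₑ := by
        gcongr
        rw [← ofReal_norm, intervalIntegral.norm_intervalIntegral_eq, ofReal_norm]
        exact (enorm_integral_le_lintegral_enorm _).trans (setLIntegral_le_lintegral _ _)
    _ ≤ _ := by
        gcongr with v
        rw [← ofReal_norm]
        refine (ENNReal.ofReal_le_ofReal (hbound v)).trans_eq ?_
        rw [ENNReal.ofReal_mul (by positivity), ENNReal.ofReal_add (by positivity) (by positivity),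
          ENNReal.ofReal_mul (by norm_num)]
        simp

/-! ### The fluctuation as a differentiable function of the frequency. -/

section Scaling

variable {Ω : Type*} [MeasurableSpace Ω] {P : Measure Ω}
  {Y : ℕ → Ω → ℝ} {φ φ' : ℝ → ℝ}

theorem continuous_normalizedFluctuation_scaled_deriv (hY : Measurable (Y 0))
    (hYint : Integrable (Y 0) P) (hφ' : Continuous φ') (hφb' : ∀ x, |φ' x| ≤ 1) (n : ℕ) (ω : Ω) :
    Continuous fun U => normalizedFluctuation P Y n (fun y => y * φ' (U * y)) ω := by
  have hmean : Continuous fun U : ℝ => ∫ ω', Y 0 ω' * φ' (U * Y 0 ω') ∂P := by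
    refine continuous_of_dominated (bound := fun ω' => |Y 0 ω'|) (fun U => ?_)
      (fun U => .of_forall fun ω' => ?_) hYint.abs (.of_forall fun ω' => by fun_prop)
    · exact (hY.mul (hφ'.measurable.comp (hY.const_mul U))).aestronglyMeasurable
    · rw [norm_mul, Real.norm_eq_abs, Real.norm_eq_abs]
      exact mul_le_of_le_one_right (abs_nonneg _) (hφb' _)
  unfold normalizedFluctuation
  fun_prop

variable [IsProbabilityMeasure P]

theorem hasDerivAt_normalizedFluctuation_scaled (hY : Measurable (Y 0)) (hYint : Integrable (Y 0) P)
    (hφ : ∀ x, HasDerivAt φ (φ' x) x) (hφ' : Measurable φ') (hφb : ∀ x, |φ x| ≤ 1)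
    (hφb' : ∀ x, |φ' x| ≤ 1) (n : ℕ) (ω : Ω) (U : ℝ) :
    HasDerivAt (fun U => normalizedFluctuation P Y n (fun y => φ (U * y)) ω)
      (normalizedFluctuation P Y n (fun y => y * φ' (U * y)) ω) U := by
  have hφm : Measurable φ :=
    (continuous_iff_continuousAt.2 fun x => (hφ x).continuousAt).measurable
  have hchain : ∀ y U : ℝ, HasDerivAt (fun U => φ (U * y)) (y * φ' (U * y)) U := fun y U =>
    ((hφ (U * y)).comp U (hasDerivAt_mul_const y)).congr_deriv (mul_comm _ _)
  have hmean : HasDerivAt (fun U => ∫ ω', φ (U * Y 0 ω') ∂P)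
      (∫ ω', Y 0 ω' * φ' (U * Y 0 ω') ∂P) U := by
    refine (hasDerivAt_integral_of_dominated_loc_of_deriv_le (bound := fun ω' => |Y 0 ω'|)
      Filter.univ_mem (.of_forall fun U => ?_) ?_ ?_ (.of_forall fun ω' V _ => ?_) hYint.abs
      (.of_forall fun ω' V _ => hchain _ _)).2
    · exact (hφm.comp (hY.const_mul U)).aestronglyMeasurable
    · exact Integrable.of_bound (hφm.comp (hY.const_mul U)).aestronglyMeasurable 1
        (.of_forall fun ω' => hφb _)
    · exact (hY.mul (hφ'.comp (hY.const_mul U))).aestronglyMeasurable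
    · rw [norm_mul, Real.norm_eq_abs, Real.norm_eq_abs]
      exact mul_le_of_le_one_right (abs_nonneg _) (hφb' _)
  exact (HasDerivAt.fun_sum fun t _ => (hchain (Y t ω) U).sub hmean).const_mul _

/-- The constant in the maximal inequality `exists_maximal_normalizedFluctuation`, in terms of the
second moment `v` of the variables. -/
def maximalConstant (v : ℝ) : ℝ≥0∞ :=
  1 + (ENNReal.ofReal v + 2 * ∫⁻ y, ENNReal.ofReal (Real.exp (y ^ 2 / 4)) ∂(gaussianReal 0 1))
    * ∫⁻ u : ℝ, ENNReal.ofReal ((1 + u ^ 2)⁻¹)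

theorem maximalConstant_lt_top (v : ℝ) : maximalConstant v < ⊤ := by
  unfold maximalConstant
  refine ENNReal.add_lt_top.2 ⟨ENNReal.one_lt_top, ENNReal.mul_lt_top (ENNReal.add_lt_top.2
    ⟨ENNReal.ofReal_lt_top, ENNReal.mul_lt_top ENNReal.ofNat_lt_top
      lintegral_exp_sq_gaussianReal_lt_top⟩) integrable_inv_one_add_sq.lintegral_lt_top⟩

/-- Maximal inequality: the exponential squares of the fluctuations of `y ↦ φ (U * y)`, damped by
`1 + U ^ 2`, have a common majorant over all `U`, whose mean is bounded independently of `n`. -/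
theorem exists_maximal_normalizedFluctuation (hmeas : ∀ t, Measurable (Y t))
    (hindep : iIndepFun Y P) (hident : ∀ t, IdentDistrib (Y t) (Y 0) P P)
    (hL2 : MemLp (Y 0) 2 P) (hφ : ∀ x, HasDerivAt φ (φ' x) x) (hφ' : Continuous φ')
    (hφb : ∀ x, |φ x| ≤ 1) (hφb' : ∀ x, |φ' x| ≤ 1) {n : ℕ} (hn : 1 ≤ n) :
    ∃ M : Ω → ℝ≥0∞, Measurable M ∧
      (∀ ω U, ENNReal.ofReal
        (Real.exp (normalizedFluctuation P Y n (fun y => φ (U * y)) ω ^ 2 / 12) / (1 + U ^ 2))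
          ≤ M ω) ∧
      ∫⁻ ω, M ω ∂P ≤ maximalConstant (∫ ω, Y 0 ω ^ 2 ∂P) := by
  set f : ℝ → Ω → ℝ := fun U ω => normalizedFluctuation P Y n (fun y => φ (U * y)) ω with hf
  set f' : ℝ → Ω → ℝ := fun U ω => normalizedFluctuation P Y n (fun y => y * φ' (U * y)) ω
    with hf'
  have hYint : Integrable (Y 0) P := hL2.integrable one_le_two
  have hφm : Measurable φ :=
    (continuous_iff_continuousAt.2 fun x => (hφ x).continuousAt).measurable
  have hgm : ∀ U : ℝ, Measurable fun y => φ (U * y) := fun U => hφm.comp (measurable_const_mul U)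
  have hgm' : ∀ U : ℝ, Measurable fun y => y * φ' (U * y) := fun U => by fun_prop
  have hder : ∀ ω U, HasDerivAt (fun U => f U ω) (f' U ω) U := fun ω U =>
    hasDerivAt_normalizedFluctuation_scaled (hmeas 0) hYint hφ hφ'.measurable hφb hφb' n ω U
  have hcont' : ∀ ω, Continuous fun U => f' U ω := fun ω =>
    continuous_normalizedFluctuation_scaled_deriv (hmeas 0) hYint hφ' hφb' n ω
  have hfm : ∀ U, Measurable (f U) := fun U => measurable_normalizedFluctuation hmeas n (hgm U)
  have hfm' : ∀ U, Measurable (f' U) := fun U => measurable_normalizedFluctuation hmeas n (hgm' U)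
  -- Continuity in $U$ and measurability in $\omega$ give joint measurability, as Tonelli requires.
  have hjoint : Measurable (Function.uncurry f) :=
    measurable_uncurry_of_continuous_of_measurable
      (fun ω => continuous_iff_continuousAt.2 fun U => (hder ω U).continuousAt) hfm
  have hjoint' : Measurable (Function.uncurry f') :=
    measurable_uncurry_of_continuous_of_measurable hcont' hfm'
  have hKm : Measurable fun p : Ω × ℝ => (ENNReal.ofReal (f' p.2 p.1 ^ 2)
      + 2 * ENNReal.ofReal (Real.exp (f p.2 p.1 ^ 2 / 4)))
        * ENNReal.ofReal ((1 + p.2 ^ 2)⁻¹) := by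
    have h1 : Measurable fun p : Ω × ℝ => f p.2 p.1 := hjoint.comp measurable_swap
    have h2 : Measurable fun p : Ω × ℝ => f' p.2 p.1 := hjoint'.comp measurable_swap
    fun_prop
  -- This integral majorant is measurable, so measurability of the supremum over uncountably many
  -- $U$ never arises.
  refine ⟨fun ω => 1 + ∫⁻ v, (ENNReal.ofReal (f' v ω ^ 2)
    + 2 * ENNReal.ofReal (Real.exp (f v ω ^ 2 / 4))) * ENNReal.ofReal ((1 + v ^ 2)⁻¹),
    measurable_const.add hKm.lintegral_prod_right', fun ω U => ?_, ?_⟩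
  · refine exp_sq_div_le_lintegral (f := fun U => f U ω) ?_ (hder ω) (hcont' ω) U
    -- At $U = 0$ the test function is the constant $\varphi(0)$, which centring removes.
    simp [hf, normalizedFluctuation]
  · rw [lintegral_add_left measurable_const, lintegral_lintegral_swap hKm.aemeasurable,
      maximalConstant]
    refine add_le_add (by simp) ?_
    rw [← lintegral_const_mul _ (by fun_prop)]
    refine lintegral_mono fun U => ?_
    have hm1 : Measurable fun ω => ENNReal.ofReal (f' U ω ^ 2) := by
      have := hfm' U
      fun_prop
    have hm2 : Measurable fun ω => ENNReal.ofReal (Real.exp (f U ω ^ 2 / 4)) := by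
      have := hfm U
      fun_prop
    rw [lintegral_mul_const _ (by fun_prop), lintegral_add_left hm1,
      lintegral_const_mul _ hm2]
    gcongr
    · have hdom : ∀ ω, ‖Y 0 ω * φ' (U * Y 0 ω)‖ ≤ ‖Y 0 ω‖ := fun ω => by
        rw [norm_mul]
        exact mul_le_of_le_one_right (norm_nonneg _) (hφb' _)
      have hL2' : MemLp (fun ω => Y 0 ω * φ' (U * Y 0 ω)) 2 P :=
        hL2.mono ((hgm' U).comp (hmeas 0)).aestronglyMeasurable (.of_forall hdom)
      refine (lintegral_normalizedFluctuation_sq_le hmeas hindep hident hn (hgm' U) hL2').trans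
        (ENNReal.ofReal_le_ofReal ?_)
      exact integral_mono hL2'.integrable_sq hL2.integrable_sq fun ω => sq_le_sq.2 (hdom ω)
    · exact lintegral_exp_sq_le_of_hasSubgaussianMGF (hfm U)
        (hasSubgaussianMGF_normalizedFluctuation hmeas hindep hident hn (hgm U) fun y => hφb _)

end Scaling

/-! ### Passage to the weighted supremum. -/

/-- Inverting the exponential gives $a^2 = 12(\log x + \log(1+U^2)) \le 12(x + 2L)$ with $L =
\log(e+|U|)$. As $w^2 \le 1$ and $w^2L \le 1$, this yields $(|a|w)^2 \le 12x + 24$; then $t \le t^2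
+ 1$. -/
theorem abs_mul_ecfWeight_le {δ : ℝ} (hδ : 0 < δ) (a U : ℝ) :
    |a| * ecfWeight δ U ≤ 12 * (Real.exp (a ^ 2 / 12) / (1 + U ^ 2)) + 25 := by
  set x := Real.exp (a ^ 2 / 12) / (1 + U ^ 2) with hx
  set L := Real.log (Real.exp 1 + |U|) with hL
  have he : 1 ≤ Real.exp 1 := Real.one_le_exp zero_le_one
  have hU : 0 ≤ |U| := abs_nonneg U
  have hL1 : 1 ≤ L := by
    rw [hL, Real.le_log_iff_exp_le (by positivity)]
    linarith
  have hx0 : 0 < x := by positivity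
  have hlog : a ^ 2 / 12 = Real.log x + Real.log (1 + U ^ 2) := by
    rw [hx, Real.log_div (Real.exp_pos _).ne' (by positivity), Real.log_exp]
    ring
  have hlogU : Real.log (1 + U ^ 2) ≤ 2 * L := by
    rw [hL, ← Real.log_rpow (by positivity)]
    -- $1 + U^2 \le (e+|U|)^2$.
    refine Real.log_le_log (by positivity) ?_
    rw [Real.rpow_two, ← sq_abs U]
    nlinarith
  have ha : a ^ 2 ≤ 12 * (x + 2 * L) := by
    have := Real.log_le_sub_one_of_pos hx0
    linarith
  set w := ecfWeight δ U with hw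
  have hw0 : 0 ≤ w := Real.rpow_nonneg (by linarith) _
  have hw1 : w ≤ 1 := Real.rpow_le_one_of_one_le_of_nonpos hL1 (by linarith)
  have hwL : w ^ 2 * L ≤ 1 := by
    have : w ^ 2 * L = L ^ (-(2 * δ)) := by
      rw [hw, ecfWeight, ← hL, ← Real.rpow_natCast, ← Real.rpow_mul (by linarith),
        ← Real.rpow_add_one (by linarith)]
      congr 1
      push_cast
      ring
    rw [this]
    exact Real.rpow_le_one_of_one_le_of_nonpos hL1 (by linarith)
  have hwsq : w ^ 2 ≤ 1 := pow_le_one₀ hw0 hw1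
  have hmain : (|a| * w) ^ 2 ≤ 12 * x + 24 := by
    rw [mul_pow, sq_abs]
    nlinarith [mul_le_mul_of_nonneg_right ha (sq_nonneg w)]
  nlinarith [sq_nonneg (|a| * w - 1)]

theorem inner_diagPoint (U : ℝ) (x : Plane) : inner ℝ (diagPoint U) x = U * (x 0 + x 1) := by
  simp [diagPoint, PiLp.inner_apply, Fin.sum_univ_two]
  ring

theorem norm_ecfProcess_diagPoint_le {Ω : Type*} [MeasurableSpace Ω] {P : Measure Ω}
    [IsProbabilityMeasure P] {X : ℕ → Ω → Plane} (hmeas : Measurable (X 0)) (n : ℕ) (U : ℝ)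
    (ω : Ω) :
    norm (ecfProcess P X n (diagPoint U) ω)
      ≤ |normalizedFluctuation P (fun t ω => X t ω 0 + X t ω 1) n
          (fun y => Real.cos (U * y)) ω|
        + |normalizedFluctuation P (fun t ω => X t ω 0 + X t ω 1) n
          (fun y => Real.sin (U * y)) ω| := by
  have hexp : ∀ x : ℝ, Complex.exp (Complex.I * (x : ℂ))
      = ((Real.cos x : ℝ) : ℂ) + ((Real.sin x : ℝ) : ℂ) * Complex.I := by
    intro x
    rw [mul_comm, Complex.exp_mul_I, Complex.ofReal_cos, Complex.ofReal_sin]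
  have hY : Measurable fun ω => U * (X 0 ω 0 + X 0 ω 1) := by fun_prop
  have hcos : Integrable (fun ω => ((Real.cos (U * (X 0 ω 0 + X 0 ω 1)) : ℝ) : ℂ)) P :=
    (Integrable.of_bound (Real.measurable_cos.comp hY).aestronglyMeasurable 1
      (.of_forall fun ω => Real.abs_cos_le_one _)).ofReal
  have hsin : Integrable (fun ω => ((Real.sin (U * (X 0 ω 0 + X 0 ω 1)) : ℝ) : ℂ)) P :=
    (Integrable.of_bound (Real.measurable_sin.comp hY).aestronglyMeasurable 1
      (.of_forall fun ω => Real.abs_sin_le_one _)).ofReal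
  have heq : ecfProcess P X n (diagPoint U) ω
      = ((normalizedFluctuation P (fun t ω => X t ω 0 + X t ω 1) n
          (fun y => Real.cos (U * y)) ω : ℝ) : ℂ)
        + ((normalizedFluctuation P (fun t ω => X t ω 0 + X t ω 1) n
          (fun y => Real.sin (U * y)) ω : ℝ) : ℂ) * Complex.I := by
    unfold ecfProcess normalizedFluctuation
    simp only [inner_diagPoint, hexp]
    rw [integral_add hcos (hsin.mul_const _), integral_mul_const, integral_complex_ofReal,
      integral_complex_ofReal]
    push_cast
    rw [mul_assoc, ← mul_add, Finset.sum_mul, ← Finset.sum_add_distrib, one_div]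
    congr 1
    exact Finset.sum_congr rfl fun t _ => by ring
  rw [heq]
  refine (norm_add_le _ _).trans_eq ?_
  simp

end

theorem theorem2p1 {Ω : Type*} [MeasurableSpace Ω] (P : Measure Ω) [IsProbabilityMeasure P]
    (X : ℕ → Ω → Plane)
    (hmeas : ∀ t, Measurable (X t))
    (hindep : iIndepFun X P)
    (hident : ∀ t, IdentDistrib (X t) (X 0) P P)
    (γ : ℝ) (hγ : 0 < γ)
    (hmoment : Integrable (fun ω => ‖X 0 ω‖ ^ (2 + γ)) P)
    (δ : ℝ) (hδ : 0 < δ) :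
    (⨆ (n : ℕ) (_ : 1 ≤ n),
      ∫⁻ ω, diagWeightedSup δ (fun u => ecfProcess P X n u ω) ∂P) < ⊤ := by
  set Y : ℕ → Ω → ℝ := fun t ω => X t ω 0 + X t ω 1 with hYdef
  have hsum : Measurable fun x : Plane => x 0 + x 1 := by fun_prop
  have hYm : ∀ t, Measurable (Y t) := fun t => hsum.comp (hmeas t)
  have hYi : iIndepFun Y P := hindep.comp (fun _ x => x 0 + x 1) fun _ => hsum
  have hYd : ∀ t, IdentDistrib (Y t) (Y 0) P P := fun t => (hident t).comp hsum
  have hYL2 : MemLp (Y 0) 2 P := by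
    refine (memLp_two_iff_integrable_sq (hYm 0).aestronglyMeasurable).2 ?_
    refine (((integrable_const (1 : ℝ)).add hmoment).const_mul 4).mono' ((hYm 0).pow_const 2).aestronglyMeasurable
      (.of_forall fun ω => ?_)
    have h0 : |X 0 ω 0| ≤ ‖X 0 ω‖ := PiLp.norm_apply_le (X 0 ω) 0
    have h1 : |X 0 ω 1| ≤ ‖X 0 ω‖ := PiLp.norm_apply_le (X 0 ω) 1
    have hY : |Y 0 ω| ≤ 2 * ‖X 0 ω‖ := (abs_add_le _ _).trans (by linarith)
    have hYsq : Y 0 ω ^ 2 ≤ 4 * ‖X 0 ω‖ ^ 2 := by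
      rw [← sq_abs]
      nlinarith [abs_nonneg (Y 0 ω)]
    have hpow : ‖X 0 ω‖ ^ 2 ≤ 1 + ‖X 0 ω‖ ^ (2 + γ) := by
      rcases le_total ‖X 0 ω‖ 1 with h | h
      · have := pow_le_one₀ (n := 2) (norm_nonneg (X 0 ω)) h
        have := Real.rpow_nonneg (norm_nonneg (X 0 ω)) (2 + γ)
        linarith
      · have := Real.rpow_le_rpow_of_exponent_le h (by linarith : (2 : ℝ) ≤ 2 + γ)
        rw [Real.rpow_two] at this
        linarith
    rw [Real.norm_eq_abs, abs_of_nonneg (sq_nonneg _)]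
    exact hYsq.trans (mul_le_mul_of_nonneg_left hpow (by norm_num))
  set K := maximalConstant (∫ ω, Y 0 ω ^ 2 ∂P)
  have hK : K < ⊤ := maximalConstant_lt_top _
  -- Cosine and sine each contribute $12K + 25$.
  have hfin : 12 * K + 12 * K + 50 < ⊤ := by
    simp [ENNReal.mul_lt_top, hK]
  refine lt_of_le_of_lt (iSup₂_le fun n hn => ?_) hfin
  obtain ⟨M, hMm, hM, hMK⟩ := exists_maximal_normalizedFluctuation hYm hYi hYd hYL2
    Real.hasDerivAt_cos Real.continuous_sin.neg Real.abs_cos_le_one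
    (fun x => (abs_neg _).trans_le (Real.abs_sin_le_one x)) hn
  obtain ⟨N, hNm, hN, hNK⟩ := exists_maximal_normalizedFluctuation hYm hYi hYd hYL2
    Real.hasDerivAt_sin Real.continuous_cos Real.abs_sin_le_one Real.abs_cos_le_one hn
  calc ∫⁻ ω, diagWeightedSup δ (fun u => ecfProcess P X n u ω) ∂P
      ≤ ∫⁻ ω, (12 * M ω + 12 * N ω + 50) ∂P := by
        refine lintegral_mono fun ω => iSup_le fun U => ?_
        have hw : 0 ≤ ecfWeight δ U := Real.rpow_nonneg
          (Real.log_nonneg (by linarith [Real.one_le_exp zero_le_one, abs_nonneg U])) _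
        have hle := (mul_le_mul_of_nonneg_right
          (norm_ecfProcess_diagPoint_le (P := P) (hmeas 0) n U ω) hw).trans
          ((add_mul _ _ _).trans_le
            (add_le_add (abs_mul_ecfWeight_le hδ _ U) (abs_mul_ecfWeight_le hδ _ U)))
        refine (ENNReal.ofReal_le_ofReal hle).trans ?_
        rw [ENNReal.ofReal_add (by positivity) (by positivity),
          ENNReal.ofReal_add (by positivity) (by positivity),
          ENNReal.ofReal_add (by positivity) (by positivity),
          ENNReal.ofReal_mul (by positivity), ENNReal.ofReal_mul (by positivity),
          add_add_add_comm]
        refine add_le_add (add_le_add ?_ ?_) ?_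
        · simpa using mul_le_mul_right (hM ω U) 12
        · simpa using mul_le_mul_right (hN ω U) 12
        · rw [← ENNReal.ofReal_add (by norm_num) (by norm_num)]
          norm_num
    _ = 12 * ∫⁻ ω, M ω ∂P + 12 * ∫⁻ ω, N ω ∂P + 50 := by
        rw [lintegral_add_right _ measurable_const, lintegral_add_right _ (hNm.const_mul _),
          lintegral_const_mul _ hMm, lintegral_const_mul _ hNm]
        simp
    _ ≤ 12 * K + 12 * K + 50 := by gcongr
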